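/- For linear orders $A,B$ let $A+B$ be their sum and $A\times B$ their lexicographic product with the first coordinate compared first, so that $\omega\times L$ is the sum of $\omega$ many copies of $L$; $\omega^*$ is the reverse of $\omega$, and $\mathbf n$ is the linear order with $n$ elements. The class $\mathrm{LO}_{\mathrm{fp}}$ of finitely presented linear orders is the smallest class of linear orders that is closed under isomorphism, contains $\mathbf 0$ and $\mathbf 1$, and contains $L_1+L_2$, $\omega\times L$ and $\omega^*\times L$ whenever it contains $L_1,L_2,L$. A linear order is bounded if it is empty or has both a least and a greatest element; it is discrete if every element other than the greatest (if there is one) has an immediate successor and every element other than the least (if there is one) has an immediate predecessor. A 3-signed tree is a pair $(T,s_T)$, where $T$ is a finite rooted tree whose vertices are finite sequences of natural numbers, the root being the empty sequence $\emptyset$ and the children of a vertex $\sigma$ being $\sigma*0,\dots,\sigma*(w(\sigma)-1)$, and where $s_T:T\to\{+,-,0\}$ takes the value $0$ exactly at the root and at the leaves. It is alternating if for each non-leaf vertex $\sigma$ exactly one of the following holds: (i) $s_T(\sigma*x)=0$ for all $x<w(\sigma)$; (ii) $w(\sigma)$ is even and $s_T(\sigma*x)=(-1)^x$ (that is, $+$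 for even $x$ and $-$ for odd $x$) for all $x<w(\sigma)$. With $\omega^{+}=\omega$, $\omega^{-}=\omega^*$, $\omega^{0}=\mathbf 1$, define recursively $$\mathrm{LIN}(T,s_T,\sigma)=\omega^{s_T(\sigma)}\times\Big(\sum_{x<w(\sigma)}\mathrm{LIN}(T,s_T,\sigma*x)\Big),$$ where the sum is read as $\mathbf 1$ if $w(\sigma)=0$. Put $\mathrm{LIN}(T,s_T)=\mathbf 0$ if $T$ has only one vertex, and $\mathrm{LIN}(T,s_T)=\mathrm{LIN}(T,s_T,\emptyset)$ otherwise. Theorem. Let $L$ be a finitely presented linear order. Then $L$ is bounded and discrete if and only if there is an alternating 3-signed tree $(T,s_T)$ such that $\mathrm{LIN}(T,s_T)\cong L$. -/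

import Mathlib

namespace FinPresLO

universe u

/-- The class of finitely presented linear orders: the smallest class of linear orders that is
closed under isomorphism, contains `0` and `1`, and is closed under `L₁ + L₂`, `ω × L` and
`ω* × L`. The lexicographic product `A × B` compares first coordinates first, so that `ω × L` is
the sum of `ω` many copies of `L`; this is Mathlib's `A ×ₗ B`. -/
inductive IsFinitelyPresented : ∀ (L : Type u) [LinearOrder L], Prop
  | zero : IsFinitelyPresented PEmpty.{u + 1}
  | one : IsFinitelyPresented PUnit.{u + 1}
  | add (L₁ L₂ : Type u) [LinearOrder L₁] [LinearOrder L₂] :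
      IsFinitelyPresented L₁ → IsFinitelyPresented L₂ → IsFinitelyPresented (L₁ ⊕ₗ L₂)
  | omega_mul (L : Type u) [LinearOrder L] :
      IsFinitelyPresented L → IsFinitelyPresented (ℕ ×ₗ L)
  | omegaStar_mul (L : Type u) [LinearOrder L] :
      IsFinitelyPresented L → IsFinitelyPresented (ℕᵒᵈ ×ₗ L)
  | iso (L₁ L₂ : Type u) [LinearOrder L₁] [LinearOrder L₂] (e : L₁ ≃o L₂) :
      IsFinitelyPresented L₁ → IsFinitelyPresented L₂

/-- A linear order is bounded if it has a least and a greatest element; the empty order counts as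
bounded. -/
def IsBoundedOrder (L : Type u) [LinearOrder L] : Prop :=
  IsEmpty L ∨ ((∃ a : L, ∀ x, a ≤ x) ∧ ∃ b : L, ∀ x, x ≤ b)

/-- A linear order is discrete if every element that is not the greatest one has an immediate
successor and every element that is not the least one has an immediate predecessor. -/
def IsDiscreteOrder (L : Type u) [LinearOrder L] : Prop :=
  ∀ x : L, (¬ IsMax x → ∃ y, x ⋖ y) ∧ (¬ IsMin x → ∃ y, y ⋖ x)

/-- Finite rooted ordered trees whose vertices carry a sign in `{+, -, 0}`. The tree
`node s w c` has root sign `s`; the root has `w` children, labelled `0, …, w - 1`, and `c x` is the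
subtree at the child `x`. These are the finite nonempty trees of finite sequences of natural
numbers in which the children of each vertex `σ` are `σ * x` for `x < w`. -/
inductive SignTree : Type
  | node (s : SignType) (w : ℕ) (c : Fin w → SignTree) : SignTree

namespace SignTree

/-- The sign of the root. -/
def sign : SignTree → SignType
  | node s _ _ => s

/-- At every vertex, the root included, the sign is `0` exactly if the vertex is a leaf. -/
def ZeroIffLeaf : SignTree → Prop
  | node s w c => (s = 0 ↔ w = 0) ∧ ∀ x, (c x).ZeroIffLeaf

/-- A vertex has sign `0` if and only if it is the root or a leaf. -/
def IsThreeSigned : SignTree → Prop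
  | node s _ c => s = 0 ∧ ∀ x, (c x).ZeroIffLeaf

/-- At every vertex that is not a leaf, exactly one of the following holds: all children have sign
`0`; or the number of children is even and the child `x` has sign `(-1) ^ x`. -/
def IsAlternating : SignTree → Prop
  | node _ w c =>
    (w ≠ 0 → Xor (∀ x, (c x).sign = 0)
      (Even w ∧ ∀ x, (c x).sign = (-1 : SignType) ^ (x : ℕ))) ∧
    ∀ x, (c x).IsAlternating

end SignTree

/-- `ω^+ = ω`, `ω^- = ω*` and `ω^0 = 1`. -/
def omegaPow : SignType → LinOrd.{0}
  | .pos => LinOrd.of ℕ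
  | .neg => LinOrd.of ℕᵒᵈ
  | .zero => LinOrd.of PUnit

/-- The order attached to a vertex: `ω^s × (∑_{x < w} …)`, where `s` is the sign of the vertex and
the sum over its `w` children is replaced by `1` if `w = 0`. -/
def SignTree.linAt : SignTree → LinOrd.{0}
  | .node s 0 _ => LinOrd.of (omegaPow s ×ₗ PUnit.{1})
  | .node s (w + 1) c => LinOrd.of (omegaPow s ×ₗ (Σₗ x : Fin (w + 1), (c x).linAt))

/-- A 3-signed tree. -/
structure ThreeSignedTree where
  tree : SignTree
  isThreeSigned : tree.IsThreeSigned

/-- The linear order `LIN(T)`: it is `0` if `T` has only one vertex, and the order attached to the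
root otherwise. -/
def ThreeSignedTree.LIN (T : ThreeSignedTree) : LinOrd.{0} :=
  match T.tree with
  | .node _ 0 _ => LinOrd.of PEmpty.{1}
  | .node s (w + 1) c => (SignTree.node s (w + 1) c).linAt

/-- A 3-signed tree is alternating. -/
def ThreeSignedTree.IsAlternating (T : ThreeSignedTree) : Prop :=
  T.tree.IsAlternating

end FinPresLO

/-! Discreteness of a sum is a matching condition at the cut: the left part has a greatest element
exactly if the right part has a least one. A tree satisfying the conditions below the root is a
point (sign 0), `ω × M` (sign +) or `ω* × M` (sign -), with `M` nonempty and bounded. So its sign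
determines its endpoints: + lacks the greatest, - lacks the least, 0 has both. Opposite neighbouring
signs always match, which gives discreteness of `LIN`; boundedness says that the first sign is not -
and the last is not +. Together these are the alternation condition.

For the converse, boundedness is dropped so that an induction on the presentation can run: every
nonempty discrete finitely presented order is a sum along a list of good trees with consecutive
signs opposite (`IsFinitelyPresented.exists_linList`). In a sum, the only matching cuts that break
this pattern are a finite order before a + tree and a finite order after a - tree; there the finite
part is absorbed (`IsGood.absorb`). In a product, the factor has both endpoints or neither. With
both, a new vertex is put on top; with neither, the product is first rotated by `ω × (X + Y) = X + ω
× (Y + X)` or its mirror image, so that the repeated block becomes bounded. -/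

namespace FinPresLO

/-! ### Rotation of products and splitting of finite lexicographic sums -/

section Isos

variable {X Y : Type*} [LinearOrder X] [LinearOrder Y]

/-- `ω × (X + Y) = X + ω × (Y + X)`, as a map. -/
def omegaRotateFun : ℕ ×ₗ (X ⊕ₗ Y) → X ⊕ₗ (ℕ ×ₗ (Y ⊕ₗ X)) := fun p =>
  match (ofLex p).1, ofLex (ofLex p).2 with
  | 0, .inl x => Sum.inlₗ x
  | n + 1, .inl x => Sum.inrₗ (toLex (n, Sum.inrₗ x))
  | n, .inr y => Sum.inrₗ (toLex (n, Sum.inlₗ y))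

/-- `ω* × (X + Y) = ω* × (Y + X) + Y`, as a map. -/
def omegaStarRotateFun : ℕᵒᵈ ×ₗ (X ⊕ₗ Y) → (ℕᵒᵈ ×ₗ (Y ⊕ₗ X)) ⊕ₗ Y := fun p =>
  match OrderDual.ofDual (ofLex p).1, ofLex (ofLex p).2 with
  | n, .inl x => Sum.inlₗ (toLex (OrderDual.toDual n, Sum.inrₗ x))
  | 0, .inr y => Sum.inrₗ y
  | n + 1, .inr y => Sum.inlₗ (toLex (OrderDual.toDual n, Sum.inlₗ y))

theorem omegaRotateFun_strictMono :
    StrictMono (omegaRotateFun : ℕ ×ₗ (X ⊕ₗ Y) → X ⊕ₗ (ℕ ×ₗ (Y ⊕ₗ X))) := by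
  intro p q h
  obtain ⟨⟨m, x⟩, rfl⟩ := toLex.surjective p
  obtain ⟨⟨n, y⟩, rfl⟩ := toLex.surjective q
  obtain ⟨x, rfl⟩ := toLex.surjective x
  obtain ⟨y, rfl⟩ := toLex.surjective y
  rw [Prod.Lex.toLex_lt_toLex] at h
  rcases x with x | x <;> rcases y with y | y <;> rcases m with _ | m <;> rcases n with _ | n <;>
    simp [Prod.Lex.toLex_lt_toLex, omegaRotateFun, Sum.Lex.toLex_lt_toLex] at h ⊢ <;>
    first | assumption | omega

theorem toLex_toDual_lt_toLex_toDual {m n : ℕ} {x y : X} :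
    toLex (OrderDual.toDual m, x) < toLex (OrderDual.toDual n, y) ↔ n < m ∨ m = n ∧ x < y := by
  simp [Prod.Lex.toLex_lt_toLex]

theorem omegaStarRotateFun_strictMono :
    StrictMono (omegaStarRotateFun : ℕᵒᵈ ×ₗ (X ⊕ₗ Y) → (ℕᵒᵈ ×ₗ (Y ⊕ₗ X)) ⊕ₗ Y) := by
  intro p q h
  obtain ⟨⟨m, x⟩, rfl⟩ := toLex.surjective p
  obtain ⟨⟨n, y⟩, rfl⟩ := toLex.surjective q
  obtain ⟨m, rfl⟩ := OrderDual.toDual.surjective m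
  obtain ⟨n, rfl⟩ := OrderDual.toDual.surjective n
  obtain ⟨x, rfl⟩ := toLex.surjective x
  obtain ⟨y, rfl⟩ := toLex.surjective y
  rw [toLex_toDual_lt_toLex_toDual] at h
  rcases x with x | x <;> rcases y with y | y <;> rcases m with _ | m <;> rcases n with _ | n <;>
    simp only [omegaStarRotateFun, Sum.Lex.toLex_lt_toLex, ofLex_toLex, OrderDual.ofDual_toDual,
      Sum.inlₗ, Sum.inrₗ, Sum.lex_inl_inl, Sum.lex_inr_inr, Sum.lex_inr_inl,
      Sum.Lex.sep, toLex_toDual_lt_toLex_toDual] at h ⊢ <;>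
    first | assumption | omega | (simp at h ⊢; done) | (simp at h ⊢; omega)

/-- `ω × (X + Y) = X + ω × (Y + X)`. -/
noncomputable def omegaRotate : ℕ ×ₗ (X ⊕ₗ Y) ≃o X ⊕ₗ (ℕ ×ₗ (Y ⊕ₗ X)) :=
  StrictMono.orderIsoOfSurjective omegaRotateFun omegaRotateFun_strictMono (by
    rintro (x | ⟨n, y | x⟩)
    · exact ⟨toLex (0, Sum.inlₗ x), rfl⟩
    -- The match also inspects the copy number, so it reduces only once `n` is zero or a successor.
    · exact ⟨toLex (n, Sum.inrₗ y), by cases n <;> rfl⟩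
    · exact ⟨toLex (n + 1, Sum.inlₗ x), rfl⟩)

/-- `ω* × (X + Y) = ω* × (Y + X) + Y`. -/
noncomputable def omegaStarRotate : ℕᵒᵈ ×ₗ (X ⊕ₗ Y) ≃o (ℕᵒᵈ ×ₗ (Y ⊕ₗ X)) ⊕ₗ Y :=
  StrictMono.orderIsoOfSurjective omegaStarRotateFun omegaStarRotateFun_strictMono (by
    rintro (⟨n, y | x⟩ | y)
    · obtain ⟨n, rfl⟩ := OrderDual.toDual.surjective n
      exact ⟨toLex (OrderDual.toDual (n + 1), Sum.inrₗ y), rfl⟩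
    · obtain ⟨n, rfl⟩ := OrderDual.toDual.surjective n
      exact ⟨toLex (OrderDual.toDual n, Sum.inlₗ x), by cases n <;> rfl⟩
    · exact ⟨toLex (OrderDual.toDual 0, Sum.inrₗ y), rfl⟩)

/-- `ω × X = X + ω × X`. -/
noncomputable def omegaSucc : ℕ ×ₗ X ≃o X ⊕ₗ (ℕ ×ₗ X) :=
  -- This is the rotation with an empty second summand.
  (Prod.Lex.prodLexCongr (.refl ℕ) (OrderIso.sumLexEmpty (β := PEmpty.{1})).symm).trans
    (omegaRotate.trans (OrderIso.sumLexCongr (.refl X)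
      (Prod.Lex.prodLexCongr (.refl ℕ) OrderIso.emptySumLex)))

/-- `ω* × X = ω* × X + X`. -/
noncomputable def omegaStarSucc : ℕᵒᵈ ×ₗ X ≃o (ℕᵒᵈ ×ₗ X) ⊕ₗ X :=
  (Prod.Lex.prodLexCongr (.refl ℕᵒᵈ) (OrderIso.emptySumLex (β := PEmpty.{1})).symm).trans
    (omegaStarRotate.trans (OrderIso.sumLexCongr
      (Prod.Lex.prodLexCongr (.refl ℕᵒᵈ) OrderIso.sumLexEmpty) (.refl X)))

/-- A lexicographic sum over `Fin (n + 1)` splits off its first summand. -/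
noncomputable def sigmaLexFinSucc {n : ℕ} (F : Fin (n + 1) → LinOrd.{0}) :
    (Σₗ x : Fin (n + 1), F x) ≃o F 0 ⊕ₗ (Σₗ x : Fin n, F x.succ) := by
  refine OrderIso.symm (StrictMono.orderIsoOfSurjective
    (fun p => match ofLex p with
      | .inl a => toLex ⟨0, a⟩
      | .inr q => toLex ⟨(ofLex q).1.succ, (ofLex q).2⟩) ?_ ?_)
  · intro p q h
    obtain ⟨p, rfl⟩ := toLex.surjective p
    obtain ⟨q, rfl⟩ := toLex.surjective q
    rcases p with p | ⟨i, p⟩ <;> rcases q with q | ⟨j, q⟩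
    · rw [Sum.Lex.toLex_lt_toLex, Sum.lex_inl_inl] at h
      exact Sigma.Lex.lt_def.2 (Or.inr ⟨rfl, h⟩)
    · exact Sigma.Lex.lt_def.2 (Or.inl (Fin.succ_pos j))
    · exact absurd h Sum.Lex.not_inr_lt_inl
    · replace h := Sum.Lex.inr_lt_inr_iff.1 h
      rcases Sigma.Lex.lt_def.1 h with h | ⟨h, h'⟩
      · exact Sigma.Lex.lt_def.2 (Or.inl (Fin.succ_lt_succ_iff.2 h))
      · dsimp at h
        subst h
        exact Sigma.Lex.lt_def.2 (Or.inr ⟨rfl, h'⟩)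
  · rintro ⟨i, a⟩
    induction i using Fin.cases with
    | zero => exact ⟨Sum.inlₗ a, rfl⟩
    | succ i => exact ⟨Sum.inrₗ (toLex ⟨i, a⟩), rfl⟩

end Isos

/-! ### Endpoints and discreteness of sums and products -/

section Predicates

/-- There is a least element. -/
def HasLeast (X : Type*) [LE X] : Prop := ∃ a : X, ∀ x, a ≤ x

/-- There is a greatest element. -/
def HasGreatest (X : Type*) [LE X] : Prop := ∃ a : X, ∀ x, x ≤ a

/-- An element has an immediate successor unless it is maximal, and an immediate predecessor
unless it is minimal. -/
def IsDiscreteAt {X : Type*} [Preorder X] (x : X) : Prop :=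
  (¬ IsMax x → ∃ y, x ⋖ y) ∧ (¬ IsMin x → ∃ y, y ⋖ x)

variable {X Y : Type*} [LinearOrder X] [LinearOrder Y]

theorem HasLeast.map (e : X ≃o Y) (h : HasLeast X) : HasLeast Y := by
  obtain ⟨a, ha⟩ := h
  exact ⟨e a, fun y => (e.le_symm_apply).1 (ha _)⟩

theorem HasGreatest.map (e : X ≃o Y) (h : HasGreatest X) : HasGreatest Y := by
  obtain ⟨a, ha⟩ := h
  exact ⟨e a, fun y => (e.symm_apply_le).1 (ha _)⟩

theorem hasLeast_congr (e : X ≃o Y) : HasLeast X ↔ HasLeast Y :=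
  ⟨.map e, .map e.symm⟩

theorem hasGreatest_congr (e : X ≃o Y) : HasGreatest X ↔ HasGreatest Y :=
  ⟨.map e, .map e.symm⟩

theorem IsDiscreteAt.map (e : X ≃o Y) {x : X} (h : IsDiscreteAt x) : IsDiscreteAt (e x) := by
  refine ⟨fun hm => ?_, fun hm => ?_⟩
  · obtain ⟨y, hy⟩ := h.1 (fun h' => hm (e.isMax_apply.2 h'))
    exact ⟨e y, (apply_covBy_apply_iff e).2 hy⟩
  · obtain ⟨y, hy⟩ := h.2 (fun h' => hm (e.isMin_apply.2 h'))
    exact ⟨e y, (apply_covBy_apply_iff e).2 hy⟩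

theorem IsDiscreteOrder.map {X : Type*} {Y : Type*} [LinearOrder X] [LinearOrder Y] (e : X ≃o Y)
    (h : IsDiscreteOrder X) : IsDiscreteOrder Y := fun y => by
  have hy := IsDiscreteAt.map e (h (e.symm y))
  rwa [e.apply_symm_apply] at hy

theorem hasLeast_sumLex [Nonempty X] : HasLeast (X ⊕ₗ Y) ↔ HasLeast X := by
  constructor
  · rintro ⟨a | a, ha⟩
    · exact ⟨a, fun x => Sum.Lex.inl_le_inl_iff.1 (ha (Sum.inlₗ x))⟩
    · exact absurd (ha (Sum.inlₗ (Classical.arbitrary X))) Sum.Lex.not_inr_le_inl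
  · rintro ⟨a, ha⟩
    refine ⟨Sum.inlₗ a, ?_⟩
    rintro (x | x)
    · exact Sum.Lex.inl_le_inl_iff.2 (ha x)
    · exact Sum.Lex.inl_le_inr _ _

theorem hasGreatest_sumLex [Nonempty Y] : HasGreatest (X ⊕ₗ Y) ↔ HasGreatest Y := by
  constructor
  · rintro ⟨a | a, ha⟩
    · exact absurd (ha (Sum.inrₗ (Classical.arbitrary Y))) Sum.Lex.not_inr_le_inl
    · exact ⟨a, fun x => Sum.Lex.inr_le_inr_iff.1 (ha (Sum.inrₗ x))⟩
  · rintro ⟨a, ha⟩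
    refine ⟨Sum.inrₗ a, ?_⟩
    rintro (x | x)
    · exact Sum.Lex.inl_le_inr _ _
    · exact Sum.Lex.inr_le_inr_iff.2 (ha x)

theorem inlₗ_covBy_inlₗ {x x' : X} : (Sum.inlₗ x : X ⊕ₗ Y) ⋖ Sum.inlₗ x' ↔ x ⋖ x' := by
  constructor
  · exact fun h => ⟨Sum.Lex.inl_lt_inl_iff.1 h.1, fun c h₁ h₂ =>
      h.2 (Sum.Lex.inl_lt_inl_iff.2 h₁) (Sum.Lex.inl_lt_inl_iff.2 h₂)⟩
  · refine fun h => ⟨Sum.Lex.inl_lt_inl_iff.2 h.1, ?_⟩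
    rintro (c | c) h₁ h₂
    · exact h.2 (Sum.Lex.inl_lt_inl_iff.1 h₁) (Sum.Lex.inl_lt_inl_iff.1 h₂)
    · exact Sum.Lex.not_inr_lt_inl h₂

theorem inrₗ_covBy_inrₗ {y y' : Y} : (Sum.inrₗ y : X ⊕ₗ Y) ⋖ Sum.inrₗ y' ↔ y ⋖ y' := by
  constructor
  · exact fun h => ⟨Sum.Lex.inr_lt_inr_iff.1 h.1, fun c h₁ h₂ =>
      h.2 (Sum.Lex.inr_lt_inr_iff.2 h₁) (Sum.Lex.inr_lt_inr_iff.2 h₂)⟩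
  · refine fun h => ⟨Sum.Lex.inr_lt_inr_iff.2 h.1, ?_⟩
    rintro (c | c) h₁ h₂
    · exact Sum.Lex.not_inr_lt_inl h₁
    · exact h.2 (Sum.Lex.inr_lt_inr_iff.1 h₁) (Sum.Lex.inr_lt_inr_iff.1 h₂)

theorem inlₗ_covBy_inrₗ {x : X} {y : Y} :
    (Sum.inlₗ x : X ⊕ₗ Y) ⋖ Sum.inrₗ y ↔ (∀ x', x' ≤ x) ∧ ∀ y', y ≤ y' := by
  constructor
  · exact fun h => ⟨fun x' => not_lt.1 fun hx =>
      h.2 (Sum.Lex.inl_lt_inl_iff.2 hx) (Sum.Lex.inl_lt_inr _ _), fun y' => not_lt.1 fun hy =>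
      h.2 (Sum.Lex.inl_lt_inr _ _) (Sum.Lex.inr_lt_inr_iff.2 hy)⟩
  · refine fun h => ⟨Sum.Lex.inl_lt_inr _ _, ?_⟩
    rintro (c | c) h₁ h₂
    · exact (h.1 c).not_gt (Sum.Lex.inl_lt_inl_iff.1 h₁)
    · exact (h.2 c).not_gt (Sum.Lex.inr_lt_inr_iff.1 h₂)

theorem not_inrₗ_covBy_inlₗ {x : X} {y : Y} : ¬ (Sum.inrₗ y : X ⊕ₗ Y) ⋖ Sum.inlₗ x :=
  fun h => Sum.Lex.not_inr_lt_inl h.1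

/-- Stated for a single point, without assuming the summands discrete: for `ω × X = X + ω × X` the
right summand is the product itself, so its discreteness is not available in advance. -/
theorem IsDiscreteAt.inlₗ {x : X} (hx : IsDiscreteAt x) (h : HasGreatest X ↔ HasLeast Y) :
    IsDiscreteAt (Sum.inlₗ x : X ⊕ₗ Y) := by
  refine ⟨fun _ => ?_, fun hm => ?_⟩
  · by_cases hmax : IsMax x
    · obtain ⟨b, hb⟩ := h.1 ⟨x, fun y => not_lt.1 hmax.not_lt⟩
      exact ⟨Sum.inrₗ b, inlₗ_covBy_inrₗ.2 ⟨fun y => not_lt.1 hmax.not_lt, hb⟩⟩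
    · obtain ⟨y, hy⟩ := hx.1 hmax
      exact ⟨Sum.inlₗ y, inlₗ_covBy_inlₗ.2 hy⟩
  · obtain ⟨y, hy⟩ := hx.2 fun hmin => hm (by
      rintro (y | y) hy
      · exact Sum.Lex.inl_le_inl_iff.2 (hmin (Sum.Lex.inl_le_inl_iff.1 hy))
      · exact Sum.Lex.inl_le_inr _ _)
    exact ⟨Sum.inlₗ y, inlₗ_covBy_inlₗ.2 hy⟩

theorem IsDiscreteAt.inrₗ {y : Y} (hy : IsDiscreteAt y) (h : HasGreatest X ↔ HasLeast Y) :
    IsDiscreteAt (Sum.inrₗ y : X ⊕ₗ Y) := by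
  refine ⟨fun hm => ?_, fun _ => ?_⟩
  · obtain ⟨z, hz⟩ := hy.1 fun hmax => hm (by
      rintro (z | z) hz
      · exact Sum.Lex.inl_le_inr _ _
      · exact Sum.Lex.inr_le_inr_iff.2 (hmax (Sum.Lex.inr_le_inr_iff.1 hz)))
    exact ⟨Sum.inrₗ z, inrₗ_covBy_inrₗ.2 hz⟩
  · by_cases hmin : IsMin y
    · obtain ⟨b, hb⟩ := h.2 ⟨y, fun z => not_lt.1 hmin.not_lt⟩
      exact ⟨Sum.inlₗ b, inlₗ_covBy_inrₗ.2 ⟨hb, fun z => not_lt.1 hmin.not_lt⟩⟩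
    · obtain ⟨z, hz⟩ := hy.2 hmin
      exact ⟨Sum.inrₗ z, inrₗ_covBy_inrₗ.2 hz⟩

/-- Neighbours inside a summand are unchanged. A greatest element of `X` is not maximal in the sum,
since `Y` is nonempty, and its successor can only be a least element of `Y`; symmetrically on the
other side. -/
theorem isDiscreteOrder_sumLex [Nonempty X] [Nonempty Y] :
    IsDiscreteOrder (X ⊕ₗ Y) ↔
      IsDiscreteOrder X ∧ IsDiscreteOrder Y ∧ (HasGreatest X ↔ HasLeast Y) := by
  refine ⟨fun h => ⟨fun x => ⟨fun hm => ?_, fun hm => ?_⟩, fun y => ⟨fun hm => ?_, fun hm => ?_⟩,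
    ⟨?_, ?_⟩⟩, ?_⟩
  · obtain ⟨y | y, hy⟩ := (h (Sum.inlₗ x)).1 fun h' => hm fun z hz =>
      Sum.Lex.inl_le_inl_iff.1 (h' (Sum.Lex.inl_le_inl_iff.2 hz))
    · exact ⟨y, inlₗ_covBy_inlₗ.1 hy⟩
    · exact absurd (fun z _ => (inlₗ_covBy_inrₗ.1 hy).1 z) hm
  · obtain ⟨y | y, hy⟩ := (h (Sum.inlₗ x)).2 fun h' => hm fun z hz =>
      Sum.Lex.inl_le_inl_iff.1 (h' (Sum.Lex.inl_le_inl_iff.2 hz))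
    · exact ⟨y, inlₗ_covBy_inlₗ.1 hy⟩
    · exact absurd hy not_inrₗ_covBy_inlₗ
  · obtain ⟨z | z, hz⟩ := (h (Sum.inrₗ y)).1 fun h' => hm fun z hz =>
      Sum.Lex.inr_le_inr_iff.1 (h' (Sum.Lex.inr_le_inr_iff.2 hz))
    · exact absurd hz not_inrₗ_covBy_inlₗ
    · exact ⟨z, inrₗ_covBy_inrₗ.1 hz⟩
  · obtain ⟨z | z, hz⟩ := (h (Sum.inrₗ y)).2 fun h' => hm fun z hz =>
      Sum.Lex.inr_le_inr_iff.1 (h' (Sum.Lex.inr_le_inr_iff.2 hz))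
    · exact absurd (fun w _ => (inlₗ_covBy_inrₗ.1 hz).2 w) hm
    · exact ⟨z, inrₗ_covBy_inrₗ.1 hz⟩
  · rintro ⟨a, ha⟩
    obtain ⟨y | y, hy⟩ := (h (Sum.inlₗ a)).1 fun h' =>
      h'.not_lt (Sum.Lex.inl_lt_inr a (Classical.arbitrary Y))
    · exact absurd (inlₗ_covBy_inlₗ.1 hy).1 (ha y).not_gt
    · exact ⟨y, (inlₗ_covBy_inrₗ.1 hy).2⟩
  · rintro ⟨a, ha⟩
    obtain ⟨y | y, hy⟩ := (h (Sum.inrₗ a)).2 fun h' =>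
      h'.not_lt (Sum.Lex.inl_lt_inr (Classical.arbitrary X) a)
    · exact ⟨y, (inlₗ_covBy_inrₗ.1 hy).1⟩
    · exact absurd (inrₗ_covBy_inrₗ.1 hy).1 (ha y).not_gt
  · rintro ⟨hX, hY, hXY⟩ (x | y)
    · exact IsDiscreteAt.inlₗ (hX x) hXY
    · exact IsDiscreteAt.inrₗ (hY y) hXY

theorem hasLeast_omega [Nonempty X] : HasLeast (ℕ ×ₗ X) ↔ HasLeast X :=
  (hasLeast_congr omegaSucc).trans hasLeast_sumLex

theorem hasGreatest_omegaStar [Nonempty X] : HasGreatest (ℕᵒᵈ ×ₗ X) ↔ HasGreatest X :=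
  (hasGreatest_congr omegaStarSucc).trans hasGreatest_sumLex

theorem not_hasGreatest_omega [Nonempty X] : ¬ HasGreatest (ℕ ×ₗ X) := by
  rintro ⟨⟨n, x⟩, h⟩
  exact (h (toLex (n + 1, x))).not_gt (Prod.Lex.toLex_lt_toLex.2 (Or.inl n.lt_succ_self))

theorem not_hasLeast_omegaStar [Nonempty X] : ¬ HasLeast (ℕᵒᵈ ×ₗ X) := by
  rintro ⟨⟨n, x⟩, h⟩
  obtain ⟨n, rfl⟩ := OrderDual.toDual.surjective n
  exact (h (toLex (OrderDual.toDual (n + 1), x))).not_gt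
    (toLex_toDual_lt_toLex_toDual.2 (Or.inl n.lt_succ_self))

theorem omegaSucc_symm_inlₗ (x : X) : omegaSucc.symm (Sum.inlₗ x) = toLex (0, x) :=
  omegaSucc.symm_apply_eq.2 rfl

theorem omegaSucc_symm_inrₗ (n : ℕ) (x : X) :
    omegaSucc.symm (Sum.inrₗ (toLex (n, x))) = toLex (n + 1, x) :=
  omegaSucc.symm_apply_eq.2 rfl

theorem omegaStarSucc_symm_inrₗ (x : X) :
    omegaStarSucc.symm (Sum.inrₗ x) = toLex (OrderDual.toDual 0, x) :=
  omegaStarSucc.symm_apply_eq.2 rfl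

theorem omegaStarSucc_symm_inlₗ (n : ℕ) (x : X) :
    omegaStarSucc.symm (Sum.inlₗ (toLex (OrderDual.toDual n, x))) =
      toLex (OrderDual.toDual (n + 1), x) :=
  omegaStarSucc.symm_apply_eq.2 rfl

/-- Both directions unfold `ω × X = X + ω × X`, whose right summand has a least element exactly if
`X` does. Conversely, a point of copy `n + 1` is a point of copy `n` of the tail, so induction on
the copy number applies. -/
theorem isDiscreteOrder_omega [Nonempty X] :
    IsDiscreteOrder (ℕ ×ₗ X) ↔ IsDiscreteOrder X ∧ (HasGreatest X ↔ HasLeast X) := by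
  refine ⟨fun h => ?_, fun ⟨hX, hXX⟩ => ?_⟩
  · obtain ⟨h₁, -, h₂⟩ := isDiscreteOrder_sumLex.1 (h.map omegaSucc)
    exact ⟨h₁, h₂.trans hasLeast_omega⟩
  · rintro ⟨n, x⟩
    have h := hXX.trans hasLeast_omega.symm
    change IsDiscreteAt (toLex (n, x))
    induction n with
    | zero =>
      rw [← omegaSucc_symm_inlₗ]
      exact (IsDiscreteAt.inlₗ (hX x) h).map _
    | succ n ih =>
      rw [← omegaSucc_symm_inrₗ]
      exact (IsDiscreteAt.inrₗ ih h).map _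

theorem isDiscreteOrder_omegaStar [Nonempty X] :
    IsDiscreteOrder (ℕᵒᵈ ×ₗ X) ↔ IsDiscreteOrder X ∧ (HasGreatest X ↔ HasLeast X) := by
  refine ⟨fun h => ?_, fun ⟨hX, hXX⟩ => ?_⟩
  · obtain ⟨-, h₁, h₂⟩ := isDiscreteOrder_sumLex.1 (h.map omegaStarSucc)
    exact ⟨h₁, hasGreatest_omegaStar.symm.trans h₂⟩
  · rintro ⟨n, x⟩
    have h := hasGreatest_omegaStar.trans hXX
    change IsDiscreteAt (toLex (n, x))
    obtain ⟨n, rfl⟩ := OrderDual.toDual.surjective n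
    induction n with
    | zero =>
      rw [← omegaStarSucc_symm_inrₗ]
      exact (IsDiscreteAt.inrₗ (hX x) h).map _
    | succ n ih =>
      rw [← omegaStarSucc_symm_inlₗ]
      exact (IsDiscreteAt.inlₗ ih h).map _

end Predicates

/-! ### Trees as lists of subtrees, and the endpoints given by signs -/

namespace SignTree

/-- The tree with root sign `s` whose children are the entries of a list. -/
def ofList (s : SignType) (l : List SignTree) : SignTree := node s l.length l.get

theorem ofList_ofFn (s : SignType) {w : ℕ} (c : Fin w → SignTree) :
    ofList s (List.ofFn c) = node s w c := by
  -- The length of `List.ofFn c` equals `w` only propositionally; with the arity a variable, the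
  -- equality can be substituted.
  have key : ∀ (w' : ℕ) (h : w' = w) (c' : Fin w' → SignTree), (∀ i, c' i = c (i.cast h)) →
      node s w' c' = node s w c := by
    rintro w' rfl c' h
    exact congrArg _ (funext h)
  exact key _ List.length_ofFn _ fun i => by simp [Fin.cast]

@[elab_as_elim]
theorem list_induction {P : SignTree → Prop}
    (ofList : ∀ s l, (∀ t ∈ l, P t) → P (ofList s l)) (t : SignTree) : P t := by
  induction t with
  | node s w c ih =>
    rw [← ofList_ofFn]
    refine ofList s _ fun t ht => ?_
    obtain ⟨i, rfl⟩ := (List.mem_ofFn' c t).1 ht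
    exact ih i

@[simp]
theorem sign_ofList (s : SignType) (l : List SignTree) : (ofList s l).sign = s := rfl

theorem zeroIffLeaf_ofList {s : SignType} {l : List SignTree} :
    (ofList s l).ZeroIffLeaf ↔ (s = 0 ↔ l = []) ∧ ∀ t ∈ l, t.ZeroIffLeaf := by
  simp only [ofList, ZeroIffLeaf, List.length_eq_zero_iff, List.forall_mem_iff_get]

/-- Consecutive signs are opposite to each other; a list of zeros counts. -/
def AltSigns (l : List SignTree) : Prop := l.IsChain fun a b => b.sign = -a.sign

/-- The signs are all zero, or they are `+, -, …, +, -`. -/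
def Balanced (l : List SignTree) : Prop :=
  AltSigns l ∧ (∀ t ∈ l.head?, t.sign ≠ -1) ∧ ∀ t ∈ l.getLast?, t.sign ≠ 1

theorem AltSigns.sign_getElem {a : SignTree} {l : List SignTree} (h : AltSigns (a :: l)) (i : ℕ)
    (hi : i < (a :: l).length) : ((a :: l)[i]).sign = (-1) ^ i * a.sign := by
  induction i with
  | zero => simp
  | succ i ih =>
    rw [List.isChain_iff_getElem.1 h i hi, ih (by omega), pow_succ]
    simp

/-- Under alternation the first sign determines the rest. It is not -, so it is 0 and all signs
vanish, or it is + and the signs are `(-1) ^ i`; then a last sign other than + forces the last index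
to be odd, hence even length. The sign at index 0 makes the cases exclusive. -/
theorem xor_iff_balanced (a : SignTree) (l : List SignTree) :
    Xor (∀ x, ((a :: l).get x).sign = 0)
      (Even (a :: l).length ∧ ∀ x, ((a :: l).get x).sign = (-1) ^ (x : ℕ)) ↔
      Balanced (a :: l) := by
  have hlast : (a :: l).getLast? = some (a :: l)[l.length] := by
    rw [List.getLast?_eq_getElem?]
    simp
  have hneg : (0 : SignType) ≠ -1 ∧ (1 : SignType) ≠ -1 ∧ (0 : SignType) ≠ 1 := by decide
  simp only [Fin.forall_iff, List.get_eq_getElem, Balanced, hlast, List.head?_cons, Option.mem_def,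
    Option.some.injEq, forall_eq']
  constructor
  · rintro (⟨h, -⟩ | ⟨⟨he, h⟩, -⟩)
    · refine ⟨List.isChain_iff_getElem.2 fun i hi => ?_, ?_, ?_⟩
      · rw [h _ hi, h i (by omega), neg_zero]
      · have := h 0 (by simp)
        rw [List.getElem_cons_zero] at this
        exact this ▸ hneg.1
      · rw [h _ (by simp)]
        exact hneg.2.2
    · refine ⟨List.isChain_iff_getElem.2 fun i hi => ?_, ?_, ?_⟩
      · rw [h _ hi, h i (by omega), pow_succ, mul_neg_one]
      · have := h 0 (by simp)
        rw [List.getElem_cons_zero, pow_zero] at this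
        exact this ▸ hneg.2.1
      · rw [List.length_cons, Nat.even_add_one, Nat.not_even_iff_odd] at he
        rw [h _ (by simp), he.neg_one_pow]
        exact hneg.2.1.symm
  · rintro ⟨hA, h0, hl⟩
    have h := hA.sign_getElem
    rw [h _ (by simp)] at hl
    rcases hs : a.sign with _ | _ | _
    · change a.sign = 0 at hs
      simp only [hs, mul_zero] at h
      refine Or.inl ⟨h, fun ⟨_, h'⟩ => ?_⟩
      have h₀ := h' 0 (by simp)
      rw [h 0 (by simp), pow_zero] at h₀
      exact hneg.2.2 h₀
    · exact absurd hs h0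
    · change a.sign = 1 at hs
      simp only [hs, mul_one] at h hl
      refine Or.inr ⟨⟨?_, h⟩, fun h' => ?_⟩
      · rw [List.length_cons, Nat.even_add_one]
        exact fun he => hl he.neg_one_pow
      · have h₀ := h 0 (by simp)
        rw [h' 0 (by simp), pow_zero] at h₀
        exact hneg.2.2 h₀

theorem isAlternating_ofList {s : SignType} {l : List SignTree} :
    (ofList s l).IsAlternating ↔ Balanced l ∧ ∀ t ∈ l, t.IsAlternating := by
  cases l with
  | nil => simp [ofList, IsAlternating, Balanced, AltSigns]
  | cons a l =>
    rw [← xor_iff_balanced, ofList, IsAlternating, List.forall_mem_iff_get]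
    simp

/-- The sum of the orders of the trees in a list. -/
def linList : List SignTree → LinOrd.{0}
  | [] => LinOrd.of PEmpty.{1}
  | t :: l => LinOrd.of (t.linAt ⊕ₗ linList l)

/-- The sum of a concatenated list is the sum of the two sums. -/
noncomputable def linListAppend : ∀ l₁ l₂ : List SignTree,
    linList (l₁ ++ l₂) ≃o linList l₁ ⊕ₗ linList l₂
  | [], _ => (OrderIso.emptySumLex (β := PEmpty)).symm
  | _ :: l₁, l₂ => (OrderIso.sumLexCongr (.refl _) (linListAppend l₁ l₂)).trans
      (OrderIso.sumLexAssoc _ _ _).symm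

/-- The sum of a list with one entry. -/
noncomputable def linListSingleton (t : SignTree) : linList [t] ≃o t.linAt :=
  OrderIso.sumLexEmpty (β := PEmpty)

/-- The lexicographic sum over the indices of a list is the sum of the list. -/
noncomputable def sigmaIsoLinList : ∀ l : List SignTree,
    (Σₗ x : Fin l.length, (l.get x).linAt) ≃o linList l
  | [] =>
    haveI : IsEmpty (Σₗ x : Fin ([] : List SignTree).length, (([] : List SignTree).get x).linAt) :=
      ⟨fun p => p.1.elim0⟩
    haveI : IsEmpty (linList []) := inferInstanceAs (IsEmpty PEmpty)
    OrderIso.ofIsEmpty _ _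
  | t :: l => (sigmaLexFinSucc fun x => ((t :: l).get x).linAt).trans
      (OrderIso.sumLexCongr (.refl _) (sigmaIsoLinList l))

/-- The order of a tree that is not a leaf. -/
noncomputable def linAtOfList (s : SignType) {l : List SignTree} (h : l ≠ []) :
    (ofList s l).linAt ≃o omegaPow s ×ₗ linList l :=
  match l, h with
  | t :: l, _ => Prod.Lex.prodLexCongr (.refl _) (sigmaIsoLinList (t :: l))

/-- The order of a leaf of sign `0` is `1`. -/
noncomputable def linAtLeaf : (ofList 0 []).linAt ≃o PUnit.{1} :=
  Prod.Lex.uniqueProd PUnit _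

/-- The order of a tree with root sign `0` that is not a leaf. -/
noncomputable def linAtZero {l : List SignTree} (h : l ≠ []) :
    (ofList 0 l).linAt ≃o linList l :=
  (linAtOfList 0 h).trans (Prod.Lex.uniqueProd PUnit _)

/-- The order of a tree with root sign `+` that is not a leaf. -/
noncomputable def linAtPos {l : List SignTree} (h : l ≠ []) :
    (ofList 1 l).linAt ≃o ℕ ×ₗ linList l := linAtOfList 1 h

/-- The order of a tree with root sign `-` that is not a leaf. -/
noncomputable def linAtNeg {l : List SignTree} (h : l ≠ []) :
    (ofList (-1) l).linAt ≃o ℕᵒᵈ ×ₗ linList l := linAtOfList (-1) h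

theorem nonempty_linList_of_forall {l : List SignTree} (h : l ≠ []) (hl : ∀ t ∈ l, Nonempty t.linAt) :
    Nonempty (linList l) := by
  cases l with
  | nil => exact absurd rfl h
  | cons a l => exact (hl a (by simp)).map Sum.inlₗ

instance instNonemptyLinAt (t : SignTree) : Nonempty t.linAt := by
  induction t using list_induction with
  | ofList s l ih =>
    cases l with
    | nil => cases s <;> exact ⟨toLex (by first | exact (0 : ℕ) | exact PUnit.unit, PUnit.unit)⟩
    | cons a l =>
      have := nonempty_linList_of_forall (l := a :: l) (by simp) ih
      have : Nonempty (omegaPow s) := by cases s <;> exact ⟨by first | exact (0 : ℕ) | exact PUnit.unit⟩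
      exact ⟨(linAtOfList s (List.cons_ne_nil a l)).symm
        (toLex (Classical.arbitrary _, Classical.arbitrary _))⟩

theorem nonempty_linList {l : List SignTree} (h : l ≠ []) : Nonempty (linList l) :=
  nonempty_linList_of_forall h fun _ _ => inferInstance

/-- A tree that satisfies the conditions on vertices below the root of an alternating 3-signed
tree. -/
def IsGood (t : SignTree) : Prop := t.ZeroIffLeaf ∧ t.IsAlternating

theorem isGood_ofList {s : SignType} {l : List SignTree} :
    (ofList s l).IsGood ↔ (s = 0 ↔ l = []) ∧ Balanced l ∧ ∀ t ∈ l, t.IsGood := by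
  simp only [IsGood, zeroIffLeaf_ofList, isAlternating_ofList, forall_and]
  tauto

/-- The order of a tree is discrete, and the sign of the root tells which endpoints it has. -/
structure HasEnds (t : SignTree) : Prop where
  hasLeast : HasLeast t.linAt ↔ t.sign ≠ -1
  hasGreatest : HasGreatest t.linAt ↔ t.sign ≠ 1
  discrete : IsDiscreteOrder t.linAt

theorem hasLeast_linList_cons {a : SignTree} {l : List SignTree} (h : a.HasEnds) :
    HasLeast (linList (a :: l)) ↔ a.sign ≠ -1 :=
  hasLeast_sumLex.trans h.hasLeast

theorem hasGreatest_linList_concat {a : SignTree} {l : List SignTree} (h : a.HasEnds) :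
    HasGreatest (linList (l ++ [a])) ↔ a.sign ≠ 1 :=
  haveI := nonempty_linList (List.cons_ne_nil a [])
  (hasGreatest_congr (linListAppend l [a])).trans
    (hasGreatest_sumLex.trans ((hasGreatest_congr (linListSingleton a)).trans h.hasGreatest))

theorem isDiscreteOrder_linList {l : List SignTree} (h : ∀ t ∈ l, t.HasEnds) (hA : AltSigns l) :
    IsDiscreteOrder (linList l) := by
  induction l with
  | nil => exact fun x => x.elim
  | cons a l ih =>
    have ha := h a (by simp)
    cases l with
    | nil => exact ha.discrete.map (linListSingleton a).symm
    | cons b l =>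
      obtain ⟨hab, hA⟩ := List.isChain_cons_cons.1 hA
      have := nonempty_linList (List.cons_ne_nil b l)
      refine isDiscreteOrder_sumLex.2 ⟨ha.discrete, ih (fun t ht => h t (by simp_all)) hA, ?_⟩
      rw [ha.hasGreatest, hasLeast_linList_cons (h b (by simp)), hab]
      simp

theorem Balanced.hasLeast {l : List SignTree} (hB : Balanced l) (h : ∀ t ∈ l, t.HasEnds)
    (hl : l ≠ []) : HasLeast (linList l) := by
  cases l with
  | nil => exact absurd rfl hl
  | cons a l => exact (hasLeast_linList_cons (h a (by simp))).2 (hB.2.1 a (by simp))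

theorem Balanced.hasGreatest {l : List SignTree} (hB : Balanced l) (h : ∀ t ∈ l, t.HasEnds)
    (hl : l ≠ []) : HasGreatest (linList l) := by
  obtain rfl | ⟨r, a, rfl⟩ := l.eq_nil_or_concat'
  · exact absurd rfl hl
  · exact (hasGreatest_linList_concat (h a (by simp))).2 (hB.2.2 a (by simp))

/-- By induction the sum of the children is discrete, and balance gives it both endpoints.
Multiplying by `ω` then destroys only the greatest element, by `ω*` only the least. -/
theorem IsGood.hasEnds {t : SignTree} (ht : t.IsGood) : t.HasEnds := by
  induction t using list_induction with
  | ofList s l ih =>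
    obtain ⟨hs, hB, hl⟩ := isGood_ofList.1 ht
    have hE := fun t ht => ih t ht (hl t ht)
    by_cases hn : l = []
    · obtain rfl := hs.2 hn
      subst hn
      refine ⟨iff_of_true ?_ (by simp), iff_of_true ?_ (by simp), ?_⟩
      · exact HasLeast.map linAtLeaf.symm ⟨PUnit.unit, fun _ => le_rfl⟩
      · exact HasGreatest.map linAtLeaf.symm ⟨PUnit.unit, fun _ => le_rfl⟩
      · refine IsDiscreteOrder.map linAtLeaf.symm fun x =>
          ⟨fun h => absurd (fun _ _ => le_rfl) h, fun h => absurd (fun _ _ => le_rfl) h⟩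
    · have h₁ := hB.hasLeast hE hn
      have h₂ := hB.hasGreatest hE hn
      have h₃ := isDiscreteOrder_linList hE hB.1
      have := nonempty_linList hn
      rcases s with _ | _ | _
      · exact absurd (hs.1 rfl) hn
      · refine ⟨iff_of_false ?_ (by simp), iff_of_true ?_ (by simp), ?_⟩
        · exact fun h => not_hasLeast_omegaStar (h.map (linAtNeg hn))
        · exact (hasGreatest_omegaStar.2 h₂).map (linAtNeg hn).symm
        · exact (isDiscreteOrder_omegaStar.2 ⟨h₃, iff_of_true h₂ h₁⟩).map (linAtNeg hn).symm
      · refine ⟨iff_of_true ?_ (by simp), iff_of_false ?_ (by simp), ?_⟩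
        · exact (hasLeast_omega.2 h₁).map (linAtPos hn).symm
        · exact fun h => not_hasGreatest_omega (h.map (linAtPos hn))
        · exact (isDiscreteOrder_omega.2 ⟨h₃, iff_of_true h₂ h₁⟩).map (linAtPos hn).symm

end SignTree

/-! ### Absorbing a single point into a product -/

section Absorption

variable {X : Type*} [LinearOrder X]

/-- `1 + ω × X = (1 + X) + ω × X = X + ω × X`. -/
theorem omega_absorb (h : Nonempty (PUnit.{1} ⊕ₗ X ≃o X)) :
    Nonempty (PUnit.{1} ⊕ₗ (ℕ ×ₗ X) ≃o ℕ ×ₗ X) := by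
  obtain ⟨e⟩ := h
  exact ⟨(OrderIso.sumLexCongr (.refl _) omegaSucc).trans <|
    (OrderIso.sumLexAssoc _ _ _).symm.trans <|
      (OrderIso.sumLexCongr e (.refl _)).trans omegaSucc.symm⟩

theorem omegaStar_absorb (h : Nonempty (X ⊕ₗ PUnit.{1} ≃o X)) :
    Nonempty ((ℕᵒᵈ ×ₗ X) ⊕ₗ PUnit.{1} ≃o ℕᵒᵈ ×ₗ X) := by
  obtain ⟨e⟩ := h
  exact ⟨(OrderIso.sumLexCongr omegaStarSucc (.refl _)).trans <|
    (OrderIso.sumLexAssoc _ _ _).trans <|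
      (OrderIso.sumLexCongr (.refl _) e).trans omegaStarSucc.symm⟩

/-- `1 + ω × (Y + 1) = ω × (1 + Y)` by rotation. Used for finite nonempty `X`, where a point can be
removed from either end with the same remainder. -/
theorem omega_absorb_of_rotate {Y : Type*} [LinearOrder Y] (e₁ : X ≃o PUnit.{1} ⊕ₗ Y)
    (e₂ : X ≃o Y ⊕ₗ PUnit.{1}) : Nonempty (PUnit.{1} ⊕ₗ (ℕ ×ₗ X) ≃o ℕ ×ₗ X) :=
  ⟨(OrderIso.sumLexCongr (.refl _) (Prod.Lex.prodLexCongr (.refl _) e₂)).trans <|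
    omegaRotate.symm.trans (Prod.Lex.prodLexCongr (.refl _) e₁.symm)⟩

theorem omegaStar_absorb_of_rotate {Y : Type*} [LinearOrder Y] (e₁ : X ≃o PUnit.{1} ⊕ₗ Y)
    (e₂ : X ≃o Y ⊕ₗ PUnit.{1}) : Nonempty ((ℕᵒᵈ ×ₗ X) ⊕ₗ PUnit.{1} ≃o ℕᵒᵈ ×ₗ X) :=
  ⟨(OrderIso.sumLexCongr (Prod.Lex.prodLexCongr (.refl _) e₁) (.refl _)).trans <|
    omegaStarRotate.symm.trans (Prod.Lex.prodLexCongr (.refl _) e₂.symm)⟩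

end Absorption

/-! ### Normal forms and their closure under sums and products -/

namespace SignTree

theorem IsGood.eq_leaf {t : SignTree} (ht : t.IsGood) (h : t.sign = 0) : t = ofList 0 [] := by
  cases t using list_induction with
  | ofList s l _ =>
    obtain rfl : s = 0 := h
    rw [(isGood_ofList.1 ht).1.1 rfl]

theorem isGood_leaf : (ofList 0 []).IsGood := by
  simp [isGood_ofList, Balanced, AltSigns]

/-- A nonempty list of good trees with alternating signs. -/
structure IsGoodList (l : List SignTree) : Prop where
  ne_nil : l ≠ []
  isGood : ∀ t ∈ l, t.IsGood
  altSigns : AltSigns l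

theorem AltSigns.sign_eq_zero {l : List SignTree} (hA : AltSigns l) {t : SignTree} (ht : t ∈ l)
    (h : t.sign = 0) : ∀ u ∈ l, u.sign = 0 := by
  cases l with
  | nil => simp
  | cons a l =>
    obtain ⟨i, hi, rfl⟩ := List.getElem_of_mem ht
    intro u hu
    obtain ⟨j, hj, rfl⟩ := List.getElem_of_mem hu
    rw [hA.sign_getElem] at h ⊢
    have : a.sign = 0 := by
      rcases neg_one_pow_eq_or SignType i with hi | hi <;> simpa [hi] using h
    simp [this]

theorem IsGoodList.eq_replicate {l : List SignTree} (hl : IsGoodList l) {t : SignTree}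
    (ht : t ∈ l) (h : t.sign = 0) : l = List.replicate l.length (ofList 0 []) :=
  List.eq_replicate_iff.2 ⟨rfl, fun u hu =>
    (hl.isGood u hu).eq_leaf (hl.altSigns.sign_eq_zero ht h u hu)⟩

/-- A leaf at the head of a list contributes a summand `1` on the left. -/
noncomputable def linListConsLeaf (l : List SignTree) :
    linList (ofList 0 [] :: l) ≃o PUnit.{1} ⊕ₗ linList l :=
  OrderIso.sumLexCongr linAtLeaf (.refl _)

/-- A leaf at the end of a list contributes a summand `1` on the right. -/
noncomputable def linListConcatLeaf (l : List SignTree) :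
    linList (l ++ [ofList 0 []]) ≃o linList l ⊕ₗ PUnit.{1} :=
  (linListAppend _ _).trans
    (OrderIso.sumLexCongr (.refl _) ((linListSingleton _).trans linAtLeaf))

theorem linList_absorb_left {a : SignTree} (l : List SignTree)
    (h : Nonempty (PUnit.{1} ⊕ₗ a.linAt ≃o a.linAt)) :
    Nonempty (PUnit.{1} ⊕ₗ linList (a :: l) ≃o linList (a :: l)) := by
  obtain ⟨e⟩ := h
  exact ⟨(OrderIso.sumLexAssoc _ _ _).symm.trans (OrderIso.sumLexCongr e (.refl _))⟩

theorem linList_absorb_right {a : SignTree} (l : List SignTree)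
    (h : Nonempty (a.linAt ⊕ₗ PUnit.{1} ≃o a.linAt)) :
    Nonempty (linList (l ++ [a]) ⊕ₗ PUnit.{1} ≃o linList (l ++ [a])) := by
  obtain ⟨e⟩ := h
  have e' : linList (l ++ [a]) ≃o linList l ⊕ₗ a.linAt :=
    (linListAppend _ _).trans (OrderIso.sumLexCongr (.refl _) (linListSingleton _))
  exact ⟨(OrderIso.sumLexCongr e' (.refl _)).trans <| (OrderIso.sumLexAssoc _ _ _).trans <|
    (OrderIso.sumLexCongr (.refl _) e).trans e'.symm⟩

/-- For sign +, the first child has sign 0 or +. If 0, all children are leaves and the block is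
finite, so rotation applies; if +, the first child absorbs the point by induction, hence so do the
block and the product. Sign - is the mirror image, with the last child. -/
theorem IsGood.absorb {t : SignTree} (ht : t.IsGood) :
    (t.sign = 1 → Nonempty (PUnit.{1} ⊕ₗ t.linAt ≃o t.linAt)) ∧
      (t.sign = -1 → Nonempty (t.linAt ⊕ₗ PUnit.{1} ≃o t.linAt)) := by
  induction t using list_induction with
  | ofList s l ih =>
    obtain ⟨hs, hB, hl⟩ := isGood_ofList.1 ht
    rw [sign_ofList]
    by_cases hn : l = []
    · rw [hs.2 hn]
      exact ⟨fun h => absurd h (by decide), fun h => absurd h (by decide)⟩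
    have hG : IsGoodList l := ⟨hn, hl, hB.1⟩
    have hrep : ∀ t ∈ l, t.sign = 0 → ∃ n, l = ofList 0 [] :: List.replicate n (ofList 0 []) ∧
        l = List.replicate n (ofList 0 []) ++ [ofList 0 []] := by
      intro t ht h0
      obtain ⟨n, hlen⟩ := Nat.exists_eq_succ_of_ne_zero (mt List.length_eq_zero_iff.1 hn)
      have hr := hG.eq_replicate ht h0
      rw [hlen] at hr
      exact ⟨n, hr, hr.trans List.replicate_succ'⟩
    constructor
    · rintro rfl
      suffices h : Nonempty (PUnit.{1} ⊕ₗ (ℕ ×ₗ linList l) ≃o ℕ ×ₗ linList l) by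
        obtain ⟨e⟩ := h
        exact ⟨(OrderIso.sumLexCongr (.refl _) (linAtPos hn)).trans (e.trans (linAtPos hn).symm)⟩
      obtain ⟨a, r, rfl⟩ := List.exists_cons_of_ne_nil hn
      rcases ha : a.sign with _ | _ | _
      · obtain ⟨n, h₁, h₂⟩ := hrep a (by simp) ha
        refine omega_absorb_of_rotate (Y := linList (List.replicate n (ofList 0 []))) ?_ ?_
        · rw [h₁]
          exact linListConsLeaf _
        · rw [h₂]
          exact linListConcatLeaf _
      · exact absurd ha (hB.2.1 a (by simp))
      · exact omega_absorb (linList_absorb_left r ((ih a (by simp) (hl a (by simp))).1 ha))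
    · rintro rfl
      suffices h : Nonempty ((ℕᵒᵈ ×ₗ linList l) ⊕ₗ PUnit.{1} ≃o ℕᵒᵈ ×ₗ linList l) by
        obtain ⟨e⟩ := h
        exact ⟨(OrderIso.sumLexCongr (linAtNeg hn) (.refl _)).trans (e.trans (linAtNeg hn).symm)⟩
      obtain ⟨r, a, rfl⟩ := l.eq_nil_or_concat'.resolve_left hn
      rcases ha : a.sign with _ | _ | _
      · obtain ⟨n, h₁, h₂⟩ := hrep a (by simp) ha
        refine omegaStar_absorb_of_rotate (Y := linList (List.replicate n (ofList 0 []))) ?_ ?_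
        · rw [h₁]
          exact linListConsLeaf _
        · rw [h₂]
          exact linListConcatLeaf _
      · exact omegaStar_absorb (linList_absorb_right r ((ih a (by simp) (hl a (by simp))).2 ha))
      · exact absurd ha (hB.2.2 a (by simp))

theorem replicate_absorb_left {X : Type*} [LinearOrder X] (h : Nonempty (PUnit.{1} ⊕ₗ X ≃o X))
    (n : ℕ) : Nonempty (linList (List.replicate n (ofList 0 [])) ⊕ₗ X ≃o X) := by
  induction n with
  | zero => exact ⟨OrderIso.emptySumLex (β := PEmpty)⟩
  | succ n ih =>
    obtain ⟨e⟩ := h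
    obtain ⟨e'⟩ := ih
    exact ⟨(OrderIso.sumLexCongr (linListConsLeaf _) (.refl _)).trans <|
      (OrderIso.sumLexAssoc _ _ _).trans <| (OrderIso.sumLexCongr (.refl _) e').trans e⟩

theorem replicate_absorb_right {X : Type*} [LinearOrder X] (h : Nonempty (X ⊕ₗ PUnit.{1} ≃o X))
    (n : ℕ) : Nonempty (X ⊕ₗ linList (List.replicate n (ofList 0 [])) ≃o X) := by
  induction n with
  | zero => exact ⟨OrderIso.sumLexEmpty (β := PEmpty)⟩
  | succ n ih =>
    obtain ⟨e⟩ := h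
    obtain ⟨e'⟩ := ih
    exact ⟨(OrderIso.sumLexCongr (.refl _) (linListConsLeaf _)).trans <|
      (OrderIso.sumLexAssoc _ _ _).symm.trans <| (OrderIso.sumLexCongr e (.refl _)).trans e'⟩

theorem IsGoodList.append {l₁ l₂ : List SignTree} (h₁ : IsGoodList l₁) (h₂ : IsGoodList l₂)
    (h : ∀ a ∈ l₁.getLast?, ∀ b ∈ l₂.head?, b.sign = -a.sign) : IsGoodList (l₁ ++ l₂) where
  ne_nil := by simp [h₁.ne_nil]
  isGood t ht := (List.mem_append.1 ht).elim (h₁.isGood t) (h₂.isGood t)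
  altSigns := List.isChain_append.2 ⟨h₁.altSigns, h₂.altSigns, h⟩

/-- Two normal forms whose sum is discrete add up to a normal form. -/
theorem IsGoodList.exists_sum {l₁ l₂ : List SignTree} (h₁ : IsGoodList l₁) (h₂ : IsGoodList l₂)
    (h : HasGreatest (linList l₁) ↔ HasLeast (linList l₂)) :
    ∃ l, IsGoodList l ∧ Nonempty (linList l ≃o linList l₁ ⊕ₗ linList l₂) := by
  obtain ⟨r, a, rfl⟩ := l₁.eq_nil_or_concat'.resolve_left h₁.ne_nil
  obtain ⟨b, l, rfl⟩ := List.exists_cons_of_ne_nil h₂.ne_nil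
  have hga := h₁.isGood a (by simp)
  have hgb := h₂.isGood b (by simp)
  rw [hasGreatest_linList_concat hga.hasEnds, hasLeast_linList_cons hgb.hasEnds] at h
  -- Of the nine sign pairs at the cut, `h` leaves (+,-), (0,0), (-,+), which may be concatenated,
  -- and the two absorbing pairs (0,+), (-,0).
  have key : b.sign = -a.sign ∨ (a.sign = 0 ∧ b.sign = 1) ∨ (a.sign = -1 ∧ b.sign = 0) := by
    generalize a.sign = x at h
    generalize b.sign = y at h
    revert h
    revert x y
    decide
  rcases key with hs | ⟨ha, hb⟩ | ⟨ha, hb⟩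
  · exact ⟨_, h₁.append h₂ (by simpa using hs), ⟨linListAppend _ _⟩⟩
  -- One sign 0 makes the whole of the left list consist of leaves, so all of it disappears.
  · obtain ⟨e⟩ := replicate_absorb_left (linList_absorb_left l (hgb.absorb.1 hb)) (r ++ [a]).length
    rw [← h₁.eq_replicate (t := a) (by simp) ha] at e
    exact ⟨_, h₂, ⟨e.symm⟩⟩
  · obtain ⟨e⟩ := replicate_absorb_right (linList_absorb_right r (hga.absorb.2 ha)) (b :: l).length
    rw [← h₂.eq_replicate (t := b) (by simp) hb] at e
    exact ⟨_, h₁, ⟨e.symm⟩⟩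

theorem IsGoodList.singleton {t : SignTree} (ht : t.IsGood) : IsGoodList [t] :=
  ⟨by simp, by simpa using ht, by simp [AltSigns]⟩

theorem IsGoodList.balanced {l : List SignTree} (h : IsGoodList l) (hL : HasLeast (linList l))
    (hG : HasGreatest (linList l)) : Balanced l := by
  refine ⟨h.altSigns, fun t ht => ?_, fun t ht => ?_⟩
  · obtain ⟨a, r, rfl⟩ := List.exists_cons_of_ne_nil h.ne_nil
    obtain rfl : a = t := by simpa using ht
    exact (hasLeast_linList_cons (h.isGood a (by simp)).hasEnds).1 hL
  · obtain ⟨r, a, rfl⟩ := l.eq_nil_or_concat'.resolve_left h.ne_nil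
    obtain rfl : a = t := by simpa using ht
    exact (hasGreatest_linList_concat (h.isGood a (by simp)).hasEnds).1 hG

theorem IsGoodList.isGood_ofList {l : List SignTree} (h : IsGoodList l)
    (hB : Balanced l) {s : SignType} (hs : s ≠ 0) : (ofList s l).IsGood :=
  SignTree.isGood_ofList.2 ⟨iff_of_false hs h.ne_nil, hB, h.isGood⟩

/-- A normal form without endpoints is `a + r + b` with `a` of sign `-` and `b` of sign `+`. -/
theorem IsGoodList.exists_eq_cons_concat {l : List SignTree} (h : IsGoodList l)
    (hL : ¬ HasLeast (linList l)) (hG : ¬ HasGreatest (linList l)) :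
    ∃ a r b, l = a :: (r ++ [b]) ∧ a.sign = -1 ∧ b.sign = 1 := by
  obtain ⟨a, r, rfl⟩ := List.exists_cons_of_ne_nil h.ne_nil
  rw [hasLeast_linList_cons (h.isGood a (by simp)).hasEnds, not_not] at hL
  obtain rfl | ⟨r, b, rfl⟩ := r.eq_nil_or_concat'
  -- A single tree of sign - would have a greatest element, so the list has a separate last entry.
  · refine absurd ((hasGreatest_linList_concat (l := []) (h.isGood a (by simp)).hasEnds).2 ?_) hG
    rw [hL]
    decide
  · rw [← List.cons_append, hasGreatest_linList_concat (h.isGood b (by simp)).hasEnds, not_not] at hG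
    exact ⟨a, r, b, rfl, hL, hG⟩

/-- Without endpoints the list is `a + r + b` with signs - and + at its ends, and `ω × (a + r + b) =
a + ω × (r + b + a)`. The new block starts with + and ends with -, hence is balanced, and the result
has signs -, +. -/
theorem IsGoodList.exists_omega {l : List SignTree} (h : IsGoodList l)
    (hLG : HasGreatest (linList l) ↔ HasLeast (linList l)) :
    ∃ l', IsGoodList l' ∧ Nonempty (linList l' ≃o ℕ ×ₗ linList l) := by
  by_cases hL : HasLeast (linList l)
  · have hB := h.balanced hL (hLG.2 hL)
    exact ⟨_, .singleton (h.isGood_ofList hB (s := 1) (by decide)),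
      ⟨(linListSingleton _).trans (linAtPos h.ne_nil)⟩⟩
  · obtain ⟨a, r, b, rfl, ha, hb⟩ := h.exists_eq_cons_concat hL (mt hLG.1 hL)
    obtain ⟨h₁, h₂, h₃⟩ := h
    have hrA : AltSigns ((r ++ [b]) ++ [a]) := by
      refine List.isChain_append.2 ⟨(List.isChain_cons.1 h₃).2, by simp, ?_⟩
      simp [ha, hb]
    have hr : IsGoodList ((r ++ [b]) ++ [a]) := ⟨by simp, fun t ht => h₂ t (by simp at ht ⊢; tauto), hrA⟩
    have hB : Balanced ((r ++ [b]) ++ [a]) := by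
      refine ⟨hrA, fun t ht => ?_, by simp [ha]⟩
      -- Whether or not `r` is empty, the head of `r ++ [b]` follows `a` in the original list and so
      -- has sign +.
      have := (List.isChain_cons.1 h₃).1 t (by cases r <;> simpa using ht)
      rw [this, ha]
      decide
    have hg : (ofList 1 ((r ++ [b]) ++ [a])).IsGood := hr.isGood_ofList hB (by decide)
    refine ⟨[a, ofList 1 ((r ++ [b]) ++ [a])], ?_, ⟨?_⟩⟩
    · refine (IsGoodList.singleton (h₂ a (by simp))).append (.singleton hg) ?_
      simp [ha]
    · refine (OrderIso.sumLexCongr (.refl _) ((linListSingleton _).trans (linAtPos hr.ne_nil))).trans ?_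
      refine OrderIso.trans ?_ omegaRotate.symm
      exact OrderIso.sumLexCongr (.refl _) (Prod.Lex.prodLexCongr (.refl _)
        ((linListAppend _ _).trans (OrderIso.sumLexCongr (.refl _) (linListSingleton a))))

/-- Mirror image: `ω* × (a + r + b) = ω* × (b + a + r) + b`, with resulting signs -, +. -/
theorem IsGoodList.exists_omegaStar {l : List SignTree} (h : IsGoodList l)
    (hLG : HasGreatest (linList l) ↔ HasLeast (linList l)) :
    ∃ l', IsGoodList l' ∧ Nonempty (linList l' ≃o ℕᵒᵈ ×ₗ linList l) := by
  by_cases hL : HasLeast (linList l)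
  · have hB := h.balanced hL (hLG.2 hL)
    exact ⟨_, .singleton (h.isGood_ofList hB (s := -1) (by decide)),
      ⟨(linListSingleton _).trans (linAtNeg h.ne_nil)⟩⟩
  · obtain ⟨a, r, b, rfl, ha, hb⟩ := h.exists_eq_cons_concat hL (mt hLG.1 hL)
    obtain ⟨h₁, h₂, h₃⟩ := h
    rw [← List.cons_append] at h₁ h₂ h₃ ⊢
    obtain ⟨h₄, -, h₅⟩ := List.isChain_append.1 h₃
    have hrA : AltSigns (b :: a :: r) := by
      refine List.isChain_cons_cons.2 ⟨?_, h₄⟩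
      simp [ha, hb]
    have hr : IsGoodList (b :: a :: r) := ⟨by simp, fun t ht => h₂ t (by simp at ht ⊢; tauto), hrA⟩
    have hB : Balanced (b :: a :: r) := by
      refine ⟨hrA, by simp [hb], fun t ht => ?_⟩
      -- The last entry of `a :: r` precedes `b` in the original list, so its sign is -.
      have := h₅ t (by simpa using ht) b (by simp)
      rw [hb] at this
      intro h'
      rw [h'] at this
      exact absurd this (by decide)
    have hg : (ofList (-1) (b :: a :: r)).IsGood := hr.isGood_ofList hB (by decide)
    refine ⟨[ofList (-1) (b :: a :: r), b], ?_, ⟨?_⟩⟩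
    · refine (IsGoodList.singleton hg).append (.singleton (h₂ b (by simp))) ?_
      simp [hb]
    · refine (OrderIso.sumLexCongr (linAtNeg hr.ne_nil) (linListSingleton _)).trans ?_
      refine omegaStarRotate.symm.trans ?_
      exact Prod.Lex.prodLexCongr (.refl _)
        ((linListAppend _ _).trans (OrderIso.sumLexCongr (.refl _) (linListSingleton b))).symm

end SignTree

/-! ### Induction on presentations and the equivalence -/

open SignTree

/-- Every nonempty discrete finitely presented linear order is a finite sum of copies of `1`, or a
sum of terms `ω × M` and `ω* × M`, in alternation, with `M` bounded and discrete. -/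
theorem IsFinitelyPresented.exists_linList {L : Type*} [LinearOrder L] (hL : IsFinitelyPresented L)
    (hd : IsDiscreteOrder L) :
    IsEmpty L ∨ ∃ l, IsGoodList l ∧ Nonempty (linList l ≃o L) := by
  induction hL with
  | zero => exact Or.inl inferInstance
  | one =>
    exact Or.inr ⟨[ofList 0 []], .singleton isGood_leaf,
      ⟨(linListSingleton _).trans (linAtLeaf.trans (OrderIso.ofUnique _ _))⟩⟩
  | add L₁ L₂ _ _ ih₁ ih₂ =>
    rcases isEmpty_or_nonempty L₁ with h₁ | h₁
    · refine (ih₂ (hd.map OrderIso.emptySumLex)).imp (fun h => ?_) ?_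
      · exact ⟨fun x => h.elim (OrderIso.emptySumLex x)⟩
      · rintro ⟨l, hl, ⟨e⟩⟩
        exact ⟨l, hl, ⟨e.trans OrderIso.emptySumLex.symm⟩⟩
    rcases isEmpty_or_nonempty L₂ with h₂ | h₂
    · refine (ih₁ (hd.map OrderIso.sumLexEmpty)).imp (fun h => ?_) ?_
      · exact ⟨fun x => h.elim (OrderIso.sumLexEmpty x)⟩
      · rintro ⟨l, hl, ⟨e⟩⟩
        exact ⟨l, hl, ⟨e.trans OrderIso.sumLexEmpty.symm⟩⟩
    obtain ⟨hd₁, hd₂, h⟩ := isDiscreteOrder_sumLex.1 hd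
    obtain ⟨l₁, hl₁, ⟨e₁⟩⟩ := (ih₁ hd₁).resolve_left (not_isEmpty_of_nonempty _)
    obtain ⟨l₂, hl₂, ⟨e₂⟩⟩ := (ih₂ hd₂).resolve_left (not_isEmpty_of_nonempty _)
    obtain ⟨l, hl, ⟨e⟩⟩ := hl₁.exists_sum hl₂
      ((hasGreatest_congr e₁).trans (h.trans (hasLeast_congr e₂).symm))
    exact Or.inr ⟨l, hl, ⟨e.trans (OrderIso.sumLexCongr e₁ e₂)⟩⟩
  | omega_mul L _ ih =>
    rcases isEmpty_or_nonempty L with h | h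
    · exact Or.inl ⟨fun p => h.elim (ofLex p).2⟩
    obtain ⟨hd', h'⟩ := isDiscreteOrder_omega.1 hd
    obtain ⟨l, hl, ⟨e⟩⟩ := (ih hd').resolve_left (not_isEmpty_of_nonempty _)
    obtain ⟨l', hl', ⟨e'⟩⟩ := hl.exists_omega
      ((hasGreatest_congr e).trans (h'.trans (hasLeast_congr e).symm))
    exact Or.inr ⟨l', hl', ⟨e'.trans (Prod.Lex.prodLexCongr (.refl _) e)⟩⟩
  | omegaStar_mul L _ ih =>
    rcases isEmpty_or_nonempty L with h | h
    · exact Or.inl ⟨fun p => h.elim (ofLex p).2⟩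
    obtain ⟨hd', h'⟩ := isDiscreteOrder_omegaStar.1 hd
    obtain ⟨l, hl, ⟨e⟩⟩ := (ih hd').resolve_left (not_isEmpty_of_nonempty _)
    obtain ⟨l', hl', ⟨e'⟩⟩ := hl.exists_omegaStar
      ((hasGreatest_congr e).trans (h'.trans (hasLeast_congr e).symm))
    exact Or.inr ⟨l', hl', ⟨e'.trans (Prod.Lex.prodLexCongr (.refl _) e)⟩⟩
  | iso L₁ L₂ e _ ih =>
    refine (ih (hd.map e.symm)).imp (fun h => ⟨fun x => h.elim (e.symm x)⟩) ?_
    rintro ⟨l, hl, ⟨e'⟩⟩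
    exact ⟨l, hl, ⟨e'.trans e⟩⟩

theorem isThreeSigned_ofList {l : List SignTree} :
    (ofList 0 l).IsThreeSigned ↔ ∀ t ∈ l, t.ZeroIffLeaf := by
  simp only [ofList, IsThreeSigned, List.forall_mem_iff_get, true_and]

/-- A 3-signed tree is given by the list of subtrees at the children of the root. -/
theorem ThreeSignedTree.exists_tree_eq (T : ThreeSignedTree) : ∃ l, T.tree = ofList 0 l := by
  obtain ⟨⟨s, w, c⟩, hs, h⟩ := T
  exact ⟨List.ofFn c, by subst hs; exact (ofList_ofFn _ c).symm⟩

theorem ThreeSignedTree.nonempty_LIN_iso {T : ThreeSignedTree} {l : List SignTree}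
    (h : T.tree = ofList 0 l) : Nonempty (T.LIN ≃o linList l) := by
  obtain ⟨t, ht⟩ := T
  obtain rfl : t = ofList 0 l := h
  cases l with
  | nil => exact ⟨.refl PEmpty⟩
  | cons a l => exact ⟨linAtZero (List.cons_ne_nil a l)⟩

theorem ThreeSignedTree.isAlternating_iff {T : ThreeSignedTree} {l : List SignTree}
    (h : T.tree = ofList 0 l) : T.IsAlternating ↔ Balanced l ∧ ∀ t ∈ l, t.IsGood := by
  obtain ⟨t, ht⟩ := T
  obtain rfl : t = ofList 0 l := h
  have hz := isThreeSigned_ofList.1 ht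
  rw [ThreeSignedTree.IsAlternating, isAlternating_ofList]
  exact and_congr_right fun _ => forall₂_congr fun t ht => (and_iff_right (hz t ht)).symm

theorem IsFinitelyPresented.bounded_discrete_iff {L : Type*} [LinearOrder L]
    (hL : IsFinitelyPresented L) :
    (IsBoundedOrder L ∧ IsDiscreteOrder L) ↔
      ∃ T : ThreeSignedTree, T.IsAlternating ∧ Nonempty (T.LIN ≃o L) := by
  constructor
  · rintro ⟨hb, hd⟩
    have key : ∀ l : List SignTree, SignTree.Balanced l → (∀ t ∈ l, t.IsGood) →
        Nonempty (linList l ≃o L) → ∃ T : ThreeSignedTree, T.IsAlternating ∧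
          Nonempty (T.LIN ≃o L) := by
      rintro l hB hl ⟨e⟩
      let T : ThreeSignedTree := ⟨ofList 0 l, isThreeSigned_ofList.2 fun t ht => (hl t ht).1⟩
      obtain ⟨e'⟩ := T.nonempty_LIN_iso rfl
      exact ⟨T, (T.isAlternating_iff rfl).2 ⟨hB, hl⟩, ⟨e'.trans e⟩⟩
    rcases hL.exists_linList hd with hE | ⟨l, hl, ⟨e⟩⟩
    -- The empty order comes from the one-vertex tree, for which `LIN` is `0` by convention.
    · have : IsEmpty (linList []) := inferInstanceAs (IsEmpty PEmpty)
      exact key [] (by simp [SignTree.Balanced, AltSigns]) (by simp) ⟨OrderIso.ofIsEmpty _ _⟩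
    · have := nonempty_linList hl.ne_nil
      obtain ⟨h₁, h₂⟩ := hb.resolve_left fun h => h.elim (e (Classical.arbitrary _))
      exact key l (hl.balanced (.map e.symm h₁) (.map e.symm h₂)) hl.isGood ⟨e⟩
  · rintro ⟨T, hT, ⟨e⟩⟩
    obtain ⟨l, h⟩ := T.exists_tree_eq
    obtain ⟨hB, hl⟩ := (T.isAlternating_iff h).1 hT
    obtain ⟨e'⟩ := T.nonempty_LIN_iso h
    have f := e'.symm.trans e
    have hE := fun t ht => (hl t ht).hasEnds
    refine ⟨?_, (isDiscreteOrder_linList hE hB.1).map f⟩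
    rcases eq_or_ne l [] with rfl | hn
    · have : IsEmpty (linList []) := inferInstanceAs (IsEmpty PEmpty)
      exact Or.inl f.symm.toEquiv.isEmpty
    · exact Or.inr ⟨(hB.hasLeast hE hn).map f, (hB.hasGreatest hE hn).map f⟩

end FinPresLO

theorem mainTheorem6 (L : Type*) [LinearOrder L]
    (hL : FinPresLO.IsFinitelyPresented L) :
    (FinPresLO.IsBoundedOrder L ∧ FinPresLO.IsDiscreteOrder L) ↔
      ∃ T : FinPresLO.ThreeSignedTree, T.IsAlternating ∧ Nonempty (T.LIN ≃o L) :=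
  hL.bounded_discrete_iff
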